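/- Corollary (Refutation of "Strong" Weighted Girth Conjectures). A weighted graph is a finite simple graph $G$ with positive real edge weights $w$; it is unweighted if all weights are $1$. For a connected weighted graph $G$, its lightness is $\ell(G) = w(G)/w(\mathrm{mst}(G))$, the total edge weight divided by the weight of a minimum spanning tree of $G$. The normalized weight of a cycle $C$ is $w^*(C) = w(C)/\max_{e \in C} w(e)$, and the weighted girth of $G$ is the minimum of $w^*(C)$ over all cycles $C$ of $G$ ($+\infty$ if $G$ has no cycle). The weighted girth conjecture of Elkin, Neiman and Solomon says that for all positive integers $n, g$, if there are connected $n$-node weighted graphs of weighted girth $g$, then some unweighted one maximizes the lightness among them. The following variants of the conjecture are false: 1. (Weighted girth $> g$.) It is false that for all positive integers $n, g$ there is an unweighted graph that maximizes the lightness over all connected $n$-node weighted graphs of weighted girth strictly larger than $g$. In fact this fails for $g = 4$ and every sufficiently large $n$. 2. (Non-integral $g$.) It is false that for all positive integers $n$ and real $g > 0$, if there are connected $n$-node weighted graphs of weighted girth $g$, then some unweighted one maximizes the lightness among them; and it is also false with "weighted girth at least $g$" in place of "weighted girth $g$". In fact there is a constant $c > 0$ such that for every sufficiently large $n$ there are a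 real number $g$ with $4 < g < 5$ and a connected $n$-node weighted graph $H$ of weighted girth exactly $g$ with $\ell(H) \ge c\, n^{2/3}$ and $\ell(H) > \ell(U)$ for every connected unweighted $n$-node graph $U$ of girth at least $g$. 3. (The example $g = 4$.) There is a constant $c > 0$ such that for every sufficiently large $n$ there is a connected $n$-node weighted graph of weighted girth $> 4$ and lightness at least $c\, n^{2/3}$, whereas for some constant $C$ every unweighted $n$-node graph of girth $> 4$ has at most $C n^{3/2}$ edges. -/

import Mathlib

open Filter

noncomputable section

/-- A weighted graph on the vertex set `V`: a simple graph with positive real edge weights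
(the values of `weight` outside the edge set play no role). -/
structure WeightedGraph (V : Type*) where
  graph : SimpleGraph V
  weight : Sym2 V → ℝ
  weight_pos : ∀ e ∈ graph.edgeSet, 0 < weight e

namespace WeightedGraph

variable {V : Type*}

/-- The total weight `w(T)` of a graph `T` under the edge weights `w` (for finite `V`). -/
def edgeWeight (w : Sym2 V → ℝ) (T : SimpleGraph V) : ℝ :=
  ∑ᶠ e ∈ T.edgeSet, w e

/-- The weight of a minimum spanning tree: the least total weight of a spanning tree of `G`.
For finite connected `G` there is a spanning tree and there are only finitely many,
so that the infimum is a minimum. -/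
def mstWeight (G : WeightedGraph V) : ℝ :=
  sInf {x | ∃ T : SimpleGraph V, T ≤ G.graph ∧ T.IsTree ∧ x = edgeWeight G.weight T}

/-- The lightness `ℓ(G) = w(G) / w(mst(G))` of a finite connected weighted graph. -/
def lightness (G : WeightedGraph V) : ℝ :=
  edgeWeight G.weight G.graph / G.mstWeight

/-- The normalized weight `w*(C) = w(C) / max_{e ∈ C} w(e)` of a cycle, given as a closed walk.
The supremum is over a finite set, nonempty if the walk is a cycle. -/
def normalizedWeight (G : WeightedGraph V) {v : V} (C : G.graph.Walk v v) : ℝ :=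
  (C.edges.map G.weight).sum / sSup (G.weight '' {e | e ∈ C.edges})

/-- The weighted girth: the minimum normalized weight of a cycle, and `⊤` if there is no cycle.
(A finite graph has finitely many cycles, so that the infimum is a minimum.) -/
def weightedGirth (G : WeightedGraph V) : EReal :=
  ⨅ (v : V) (C : G.graph.Walk v v) (_ : C.IsCycle), (G.normalizedWeight C : EReal)

/-- All edges have weight `1`. -/
def IsUnweighted (G : WeightedGraph V) : Prop :=
  ∀ e ∈ G.graph.edgeSet, G.weight e = 1

/-- Among the connected weighted graphs with `n` vertices and weighted girth in `S`, the
lightness is maximized by an unweighted one (provided that there are such graphs at all).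
With `S = {g}` this is the weighted girth conjecture for `n` and `g`. -/
def MaximizedByUnweighted (n : ℕ) (S : Set EReal) : Prop :=
  (∃ H : WeightedGraph (Fin n), H.graph.Connected ∧ H.weightedGirth ∈ S) →
    ∃ U : WeightedGraph (Fin n), U.graph.Connected ∧ U.weightedGirth ∈ S ∧ U.IsUnweighted ∧
      ∀ H : WeightedGraph (Fin n), H.graph.Connected → H.weightedGirth ∈ S →
        H.lightness ≤ U.lightness

end WeightedGraph

end

/-! An unweighted graph of weighted girth greater than 4 has neither triangles nor 4-cycles, hence
at most `n ^ (3 / 2)` edges and lightness `O(n ^ (1 / 2))`. Weights beat this because a threshold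
just above 4 can be met with four edges of weight 1 plus one very light edge.

Split the nodes into `2 p ^ 2` clusters of size at least `p`, with `n` of order `p ^ 3`. Span each
cluster by a star of edges of weight `ε`, and join every left cluster to every right cluster by one
edge of weight 1. Contracting the clusters leaves a complete bipartite graph without parallel edges,
so every cycle has at least four heavy edges. If the endpoints are chosen so that the heavy edges
alone contain no 4-cycle, every cycle has a fifth edge, and the weighted girth is at least `4 + ε`
(`BipartiteClustering.le_normalizedWeight`). An incidence rule over `ZMod p` provides such endpoints
(`ofSurjective`).

The heavy weight is `p ^ 4`, while a spanning subgraph made of the stars and `O(p ^ 2)` heavy edges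
is connected. With `ε = 1 / n` the stars weigh at most 1 in total, so the lightness is of order `p ^
2`, that is `n ^ (2 / 3)`. An explicit 6-cycle bounds the girth above by `4 + 2ε`, so it is a real
number strictly between 4 and 5. This one family refutes all the variants. -/

noncomputable section

/-! ### Closed trails across cuts, and the edge bound for graphs of girth above 4 -/

namespace SimpleGraph

variable {V : Type*} {G : SimpleGraph V}

/-- A closed trail that visits both sides of a cut crosses it in at least two edges. -/
lemma Walk.IsTrail.exists_boundary_edge_ne {v x y : V} {C : G.Walk v v} (hC : C.IsTrail)
    (S : Set V) (hx : x ∈ C.support) (hy : y ∈ C.support) (hxS : x ∈ S) (hyS : y ∉ S)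
    (e : Sym2 V) : ∃ a ∈ S, ∃ b ∉ S, s(a, b) ∈ C.edges ∧ s(a, b) ≠ e := by
  classical
  have hyW : y ∈ (C.rotate _ hx).support := (C.mem_support_rotate_iff _ hx).2 hy
  have hW : (C.rotate _ hx).edges.Nodup := (hC.rotate hx).edges_nodup
  have hmem : ∀ e, e ∈ (C.rotate _ hx).edges → e ∈ C.edges :=
    fun e he => (C.rotate_edges _ hx).mem_iff.1 he
  -- Started at `x` and split at `y`, the trail becomes two edge-disjoint walks between `x` and `y`.
  -- Each crosses the cut, so at most one of the two crossing edges is `e`.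
  rw [← (C.rotate _ hx).take_spec hyW, Walk.edges_append, List.nodup_append] at hW
  rw [← (C.rotate _ hx).take_spec hyW, Walk.edges_append] at hmem
  obtain ⟨d, hd, hd1, hd2⟩ :=
    ((C.rotate _ hx).takeUntil y hyW).exists_boundary_dart S hxS hyS
  obtain ⟨d', hd', hd'1, hd'2⟩ :=
    ((C.rotate _ hx).dropUntil y hyW).exists_boundary_dart Sᶜ hyS (by simpa using hxS)
  have h1 : s(d.fst, d.snd) ∈ ((C.rotate _ hx).takeUntil y hyW).edges :=
    List.mem_map.2 ⟨d, hd, rfl⟩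
  have h2 : s(d'.snd, d'.fst) ∈ ((C.rotate _ hx).dropUntil y hyW).edges :=
    List.mem_map.2 ⟨d', hd', Sym2.eq_swap⟩
  by_cases he : s(d.fst, d.snd) = e
  · refine ⟨d'.snd, by simpa using hd'2, d'.fst, hd'1, hmem _ (List.mem_append_right _ h2), ?_⟩
    rw [← he]
    exact (hW.2.2 _ h1 _ h2).symm
  · exact ⟨_, hd1, _, hd2, hmem _ (List.mem_append_left _ h1), he⟩

/-- Two distinct common neighbours of `a` and `b` would close a 4-cycle. -/
lemma eq_of_four_lt_egirth (h : 4 < G.egirth) {a b v w : V} (hab : a ≠ b)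
    (hva : G.Adj v a) (hvb : G.Adj v b) (hwa : G.Adj w a) (hwb : G.Adj w b) : v = w := by
  by_contra hvw
  let C : G.Walk a a := .cons hva.symm (.cons hvb (.cons hwb.symm (.cons hwa .nil)))
  have hC : C.IsCycle := by
    simp [C, Walk.isCycle_def, Walk.isTrail_def, hva.ne, hvb.ne, hwa.ne, hva.ne',
      hwa.ne', hwb.ne', hab, hab.symm, hvw]
  have := h.trans_le (egirth_le_length hC)
  simp [C] at this

/-- Double counting of the triples `(v, a, b)` with `a` and `b` both adjacent to `v`: a pair `a ≠ b`
has at most one such `v`, and the diagonal contributes the degree sum. -/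
lemma sum_degree_sq_le [Fintype V] [DecidableRel G.Adj] (h : 4 < G.egirth) :
    ∑ v, G.degree v ^ 2 ≤ ∑ v, G.degree v + Fintype.card V ^ 2 := by
  classical
  have hdeg : ∀ v, G.degree v = ∑ a, if G.Adj v a then 1 else 0 := by
    intro v
    rw [Finset.sum_boole, ← card_neighborFinset_eq_degree, neighborFinset_eq_filter]
    simp
  have hcommon : ∀ a b, ∑ v, (if G.Adj v a then 1 else 0) * (if G.Adj v b then 1 else 0) ≤
      (if a = b then G.degree a else 0) + 1 := by
    intro a b
    split_ifs with hab
    · subst hab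
      rw [hdeg a]
      refine le_add_right (Finset.sum_le_sum fun v _ => ?_)
      by_cases hva : G.Adj v a <;> simp [hva, G.adj_comm a v]
    · have : ∀ v, (if G.Adj v a then 1 else 0) * (if G.Adj v b then 1 else 0) =
          if G.Adj v a ∧ G.Adj v b then 1 else 0 := by
        intro v
        split_ifs <;> simp_all
      simp_rw [this]
      rw [Finset.sum_boole, zero_add, Nat.cast_id, Finset.card_le_one]
      intro v hv w hw
      simp only [Finset.mem_filter, Finset.mem_univ, true_and] at hv hw
      exact eq_of_four_lt_egirth h hab hv.1 hv.2 hw.1 hw.2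
  calc ∑ v, G.degree v ^ 2
      = ∑ a, ∑ b, ∑ v, (if G.Adj v a then 1 else 0) * (if G.Adj v b then 1 else 0) := by
        simp_rw [sq, hdeg, Finset.sum_mul_sum]
        rw [Finset.sum_comm]
        exact Finset.sum_congr rfl fun a _ => Finset.sum_comm
    _ ≤ ∑ a, ∑ b, ((if a = b then G.degree a else 0) + 1) :=
        Finset.sum_le_sum fun a _ => Finset.sum_le_sum fun b _ => hcommon a b
    _ = _ := by simp [Finset.sum_add_distrib, sq]

/-- A graph without triangles and `4`-cycles has at most `n ^ (3 / 2)` edges. -/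
lemma ncard_edgeSet_sq_le [Fintype V] (h : 4 < G.egirth) :
    G.edgeSet.ncard ^ 2 ≤ Fintype.card V ^ 3 := by
  classical
  have hm : G.edgeSet.ncard = G.edgeFinset.card := by
    rw [← coe_edgeFinset, Set.ncard_coe_finset]
  have h1 := sum_degree_sq_le h
  have h2 := G.sum_degrees_eq_twice_card_edges
  have h3 := sq_sum_le_card_mul_sum_sq (s := Finset.univ) (f := fun v => G.degree v)
  rw [h2] at h1 h3
  rw [Finset.card_univ] at h3
  rw [hm]
  have h4 : ∑ v, G.degree v ≤ ∑ _v : V, Fintype.card V :=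
    Finset.sum_le_sum fun v _ => (G.degree_lt_card_verts v).le
  rw [h2] at h4
  simp only [Finset.sum_const, Finset.card_univ, smul_eq_mul] at h4
  have h5 := Nat.mul_le_mul_left (Fintype.card V) h1
  have h6 := Nat.mul_le_mul_left (Fintype.card V) h4
  -- With `m` edges, Cauchy–Schwarz gives `(2m) ^ 2 ≤ n (2m + n ^ 2)`, and `2m ≤ n ^ 2` makes the
  -- right side at most `2 n ^ 3`.
  nlinarith

lemma ncard_edgeSet_le_rpow {n : ℕ} {G : SimpleGraph (Fin n)} (h : 4 < G.egirth) :
    (G.edgeSet.ncard : ℝ) ≤ (n : ℝ) ^ ((3 : ℝ) / 2) := by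
  have h1 : ((G.edgeSet.ncard : ℝ)) ^ 2 ≤ (n : ℝ) ^ 3 := by
    have := ncard_edgeSet_sq_le h
    rw [Fintype.card_fin] at this
    exact_mod_cast this
  refine le_of_sq_le_sq ?_ (by positivity)
  rw [← Real.rpow_mul_natCast (by positivity)]
  norm_num
  exact h1

end SimpleGraph

/-! ### Lightness and weighted girth: the unweighted case and general bounds -/

namespace WeightedGraph

variable {V : Type*}

lemma edgeWeight_eq_sum [Finite V] (w : Sym2 V → ℝ) (T : SimpleGraph V) :
    edgeWeight w T = ∑ e ∈ (Set.toFinite T.edgeSet).toFinset, w e :=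
  finsum_mem_eq_finite_toFinset_sum _ _

lemma edgeWeight_mono [Finite V] (G : WeightedGraph V) {S T : SimpleGraph V} (hST : S ≤ T)
    (hT : T ≤ G.graph) : edgeWeight G.weight S ≤ edgeWeight G.weight T := by
  rw [edgeWeight_eq_sum, edgeWeight_eq_sum]
  refine Finset.sum_le_sum_of_subset_of_nonneg ?_ fun e he _ => ?_
  · simpa using hST
  · exact (G.weight_pos e (SimpleGraph.edgeSet_mono hT (by simpa using he))).le

lemma edgeWeight_eq_ncard [Finite V] {w : Sym2 V → ℝ} {T : SimpleGraph V}
    (h : ∀ e ∈ T.edgeSet, w e = 1) : edgeWeight w T = T.edgeSet.ncard := by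
  rw [edgeWeight_eq_sum, Finset.sum_congr rfl fun e he => h e (by simpa using he),
    Set.ncard_eq_toFinset_card _]
  simp

lemma ncard_edgeSet_of_isTree [Finite V] {T : SimpleGraph V} (hT : T.IsTree) :
    T.edgeSet.ncard + 1 = Nat.card V := by
  classical
  have := Fintype.ofFinite V
  rw [Nat.card_eq_fintype_card, ← hT.card_edgeFinset, ← SimpleGraph.coe_edgeFinset,
    Set.ncard_coe_finset]

/-- All spanning trees have the same number of edges, so the infimum is over a singleton. -/
lemma mstWeight_of_isUnweighted [Finite V] {G : WeightedGraph V} (hG : G.graph.Connected)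
    (hU : G.IsUnweighted) : G.mstWeight = Nat.card V - 1 := by
  have hT : ∀ T ≤ G.graph, T.IsTree → edgeWeight G.weight T = Nat.card V - 1 := by
    intro T hle hT
    rw [edgeWeight_eq_ncard fun e he => hU e (SimpleGraph.edgeSet_mono hle he),
      ← ncard_edgeSet_of_isTree hT]
    simp
  obtain ⟨T, hle, hT'⟩ := hG.exists_isTree_le
  have : {x | ∃ T : SimpleGraph V, T ≤ G.graph ∧ T.IsTree ∧ x = edgeWeight G.weight T} =
      {(Nat.card V - 1 : ℝ)} := by
    ext x
    constructor
    · rintro ⟨S, hS, hS', rfl⟩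
      exact hT S hS hS'
    · rintro rfl
      exact ⟨T, hle, hT', (hT T hle hT').symm⟩
  rw [mstWeight, this, csInf_singleton]

lemma weightedGirth_le {G : WeightedGraph V} {v : V} {C : G.graph.Walk v v} (hC : C.IsCycle) :
    G.weightedGirth ≤ G.normalizedWeight C :=
  iInf_le_of_le v (iInf_le_of_le C (iInf_le _ hC))

lemma normalizedWeight_of_isUnweighted {G : WeightedGraph V} (hU : G.IsUnweighted) {v : V}
    {C : G.graph.Walk v v} (hC : C.IsCycle) : G.normalizedWeight C = C.length := by
  have h1 : ∀ e ∈ C.edges, G.weight e = 1 := fun e he => hU e (C.edges_subset_edgeSet he)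
  have h2 : G.weight '' {e | e ∈ C.edges} = {1} := by
    ext x
    constructor
    · rintro ⟨e, he, rfl⟩
      exact h1 e he
    · rintro rfl
      have hne : C.edges ≠ [] := by
        intro h
        have := hC.three_le_length
        rw [← C.length_edges, h] at this
        simp at this
      exact ⟨_, List.head_mem hne, h1 _ (List.head_mem hne)⟩
  rw [normalizedWeight, h2, csSup_singleton, List.map_congr_left h1]
  simp

lemma four_lt_egirth_of_isUnweighted {G : WeightedGraph V} (hU : G.IsUnweighted)
    (h : ((4 : ℝ) : EReal) < G.weightedGirth) : 4 < G.graph.egirth := by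
  have : (5 : ℕ∞) ≤ G.graph.egirth := by
    rw [SimpleGraph.le_egirth]
    intro v C hC
    have h1 := h.trans_le (weightedGirth_le hC)
    rw [normalizedWeight_of_isUnweighted hU hC, EReal.coe_lt_coe_iff] at h1
    have h2 : 5 ≤ C.length := by exact_mod_cast h1
    exact_mod_cast h2
  exact lt_of_lt_of_le (by norm_num) this

/-- An unweighted graph of girth more than `4` has lightness `O(n ^ (1 / 2))`. -/
lemma lightness_le_of_isUnweighted {n : ℕ} (hn : 2 ≤ n) {G : WeightedGraph (Fin n)}
    (hG : G.graph.Connected) (hU : G.IsUnweighted) (h : ((4 : ℝ) : EReal) < G.weightedGirth) :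
    G.lightness ≤ 2 * (n : ℝ) ^ ((1 : ℝ) / 2) := by
  have h1 := SimpleGraph.ncard_edgeSet_le_rpow (four_lt_egirth_of_isUnweighted hU h)
  have hn' : (2 : ℝ) ≤ n := by exact_mod_cast hn
  rw [lightness, mstWeight_of_isUnweighted hG hU, edgeWeight_eq_ncard hU, Nat.card_fin,
    div_le_iff₀ (by linarith)]
  have h2 : (n : ℝ) ^ ((3 : ℝ) / 2) = (n : ℝ) ^ ((1 : ℝ) / 2) * n := by
    rw [← Real.rpow_add_one (by linarith)]
    norm_num
  have h3 : 0 ≤ (n : ℝ) ^ ((1 : ℝ) / 2) := by positivity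
  nlinarith

/-- It suffices to bound the weight of some connected spanning subgraph from above. -/
lemma le_lightness [Finite V] [Nontrivial V] {G : WeightedGraph V} {S : SimpleGraph V}
    (hS : S ≤ G.graph) (hS' : S.Connected) {a b : ℝ} (ha : 0 ≤ a)
    (hGa : a ≤ edgeWeight G.weight G.graph) (hSb : edgeWeight G.weight S ≤ b) :
    a / b ≤ G.lightness := by
  have hpos : ∀ T ≤ G.graph, T.IsTree → 0 < edgeWeight G.weight T := by
    intro T hT hT'
    rw [edgeWeight_eq_sum]
    refine Finset.sum_pos (fun e he => G.weight_pos e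
      (SimpleGraph.edgeSet_mono hT (by simpa using he))) ?_
    have h1 := ncard_edgeSet_of_isTree hT'
    have h2 := Finite.one_lt_card (α := V)
    have h3 : T.edgeSet.Nonempty := Set.nonempty_of_ncard_ne_zero (by omega)
    simpa using h3
  obtain ⟨T, hT, hT'⟩ := hS'.exists_isTree_le
  have hfin : {x | ∃ T : SimpleGraph V, T ≤ G.graph ∧ T.IsTree ∧
      x = edgeWeight G.weight T}.Finite :=
    (Set.finite_range fun T : SimpleGraph V => edgeWeight G.weight T).subset
      (by rintro x ⟨T, -, -, rfl⟩; exact ⟨T, rfl⟩)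
  obtain ⟨R, hR, hR', hR''⟩ :=
    Set.Nonempty.csInf_mem (by exact ⟨_, T, hT.trans hS, hT', rfl⟩) hfin
  -- Positivity matters, since division by zero would make the lightness 0. It holds because the
  -- infimum over the finitely many trees is attained and a tree on at least two vertices has an
  -- edge.
  have h1 : 0 < G.mstWeight := by
    rw [mstWeight, hR'']
    exact hpos R hR hR'
  have h2 : G.mstWeight ≤ b :=
    (csInf_le hfin.bddBelow ⟨T, hT.trans hS, hT', rfl⟩).trans
      ((edgeWeight_mono G hT hS).trans hSb)
  rw [lightness]
  gcongr
  exact ha.trans hGa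

/-- If no edge is heavier than `1`, the normalized weight of a cycle is at least its weight. -/
lemma sum_le_normalizedWeight {G : WeightedGraph V} (hG : ∀ e, G.weight e ≤ 1) {v : V}
    {C : G.graph.Walk v v} (hC : C.IsCycle) {s : Finset (Sym2 V)} (hs : ∀ e ∈ s, e ∈ C.edges) :
    ∑ e ∈ s, G.weight e ≤ G.normalizedWeight C := by
  classical
  have hpos : ∀ e ∈ C.edges, 0 < G.weight e :=
    fun e he => G.weight_pos e (C.edges_subset_edgeSet he)
  have h1 : ∑ e ∈ s, G.weight e ≤ (C.edges.map G.weight).sum := by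
    rw [← List.sum_toFinset _ hC.1.1.edges_nodup]
    exact Finset.sum_le_sum_of_subset_of_nonneg (fun e he => by simpa using hs e he)
      fun e he _ => (hpos e (by simpa using he)).le
  have hne : C.edges ≠ [] := by
    intro h
    have := hC.three_le_length
    rw [← C.length_edges, h] at this
    simp at this
  have hbdd : BddAbove (G.weight '' {e | e ∈ C.edges}) :=
    ⟨1, by rintro x ⟨e, -, rfl⟩; exact hG e⟩
  have h2 : 0 < sSup (G.weight '' {e | e ∈ C.edges}) :=
    (hpos _ (List.head_mem hne)).trans_le (le_csSup hbdd ⟨_, List.head_mem hne, rfl⟩)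
  have h3 : sSup (G.weight '' {e | e ∈ C.edges}) ≤ 1 :=
    csSup_le ⟨_, _, List.head_mem hne, rfl⟩ (by rintro x ⟨e, -, rfl⟩; exact hG e)
  have h4 : 0 ≤ (C.edges.map G.weight).sum := by
    refine List.sum_nonneg fun x hx => ?_
    obtain ⟨e, he, rfl⟩ := List.mem_map.1 hx
    exact (hpos e he).le
  exact h1.trans (le_div_self h4 h2 h3)

end WeightedGraph

/-! ### Clustered graphs -/

/-- The vertex set `V` is partitioned into clusters, indexed by `I` on the left and by `J` on the
right, each with a root. For all `i` and `j` the clusters `i` and `j` are joined by one edge from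
`left i j` to `right i j`, and these edges do not contain a `4`-cycle. -/
structure BipartiteClustering (V I J : Type*) where
  cluster : V → I ⊕ J
  root : I ⊕ J → V
  left : I → J → V
  right : I → J → V
  cluster_root : ∀ k, cluster (root k) = k
  cluster_left : ∀ i j, cluster (left i j) = .inl i
  cluster_right : ∀ i j, cluster (right i j) = .inr j
  no_four_cycle : ∀ i i' j j', left i j = left i j' → left i' j = left i' j' →
    right i j = right i' j → right i j' = right i' j' → i = i' ∨ j = j'

namespace BipartiteClustering

variable {V I J : Type*} (B : BipartiteClustering V I J)

/-- The edges between different clusters. -/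
def heavyEdge (i : I) (j : J) : Sym2 V := s(B.left i j, B.right i j)

/-- The edge between a vertex and the root of its cluster. -/
def lightEdge (v : V) : Sym2 V := s(v, B.root (B.cluster v))

/-- The graph that consists of the edges between different clusters and of a spanning star of
every cluster. -/
def graph : SimpleGraph V :=
  .fromEdgeSet (Set.range B.lightEdge ∪ Set.range (fun p : I × J => B.heavyEdge p.1 p.2))

lemma left_ne_right (i i' : I) (j j' : J) : B.left i j ≠ B.right i' j' := by
  intro h
  have := congrArg B.cluster h
  simp [B.cluster_left, B.cluster_right] at this

lemma heavyEdge_inj {i i' : I} {j j' : J} :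
    B.heavyEdge i j = B.heavyEdge i' j' ↔ i = i' ∧ j = j' := by
  constructor
  · intro h
    rw [heavyEdge, heavyEdge, Sym2.eq_iff] at h
    rcases h with ⟨h1, h2⟩ | ⟨h1, -⟩
    · have h1 := congrArg B.cluster h1
      have h2 := congrArg B.cluster h2
      simp only [B.cluster_left, B.cluster_right, Sum.inl.injEq, Sum.inr.injEq] at h1 h2
      exact ⟨h1, h2⟩
    · exact absurd h1 (B.left_ne_right _ _ _ _)
  · rintro ⟨rfl, rfl⟩
    rfl

lemma cluster_eq_of_eq_lightEdge {a b v : V} (h : s(a, b) = B.lightEdge v) :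
    B.cluster a = B.cluster b := by
  rw [lightEdge, Sym2.eq_iff] at h
  rcases h with ⟨rfl, rfl⟩ | ⟨rfl, rfl⟩ <;> simp [B.cluster_root]

lemma heavyEdge_ne_lightEdge (i : I) (j : J) (v : V) : B.heavyEdge i j ≠ B.lightEdge v := by
  intro h
  have := B.cluster_eq_of_eq_lightEdge h
  simp [B.cluster_left, B.cluster_right] at this

lemma heavyEdge_mem (i : I) (j : J) : B.heavyEdge i j ∈ B.graph.edgeSet := by
  rw [graph, SimpleGraph.edgeSet_fromEdgeSet]
  exact ⟨Or.inr ⟨(i, j), rfl⟩, by simpa [heavyEdge] using B.left_ne_right i i j j⟩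

lemma eq_of_mem {e : Sym2 V} (he : e ∈ B.graph.edgeSet) :
    (∃ v, e = B.lightEdge v) ∨ ∃ i j, e = B.heavyEdge i j := by
  rw [graph, SimpleGraph.edgeSet_fromEdgeSet] at he
  rcases he.1 with ⟨v, rfl⟩ | ⟨p, rfl⟩
  · exact Or.inl ⟨v, rfl⟩
  · exact Or.inr ⟨p.1, p.2, rfl⟩

open Classical in
/-- Edges between different clusters have weight `1`, and edges within a cluster weight `ε`. -/
def weighted (ε : ℝ) (hε : 0 < ε) : WeightedGraph V where
  graph := B.graph
  weight e := if ∃ i j, e = B.heavyEdge i j then 1 else ε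
  weight_pos e _ := by split_ifs <;> linarith

variable {ε : ℝ} {hε : 0 < ε}

lemma weight_heavyEdge (i : I) (j : J) : (B.weighted ε hε).weight (B.heavyEdge i j) = 1 :=
  if_pos ⟨i, j, rfl⟩

lemma weight_lightEdge (v : V) : (B.weighted ε hε).weight (B.lightEdge v) = ε :=
  if_neg fun ⟨i, j, h⟩ => B.heavyEdge_ne_lightEdge i j v h.symm

lemma weight_le_one (hε1 : ε ≤ 1) (e : Sym2 V) : (B.weighted ε hε).weight e ≤ 1 := by
  simp only [weighted]
  split_ifs <;> linarith

/-! ### Every cycle has normalized weight at least `4 + ε` -/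

section Cycle

variable {v₀ : V} {C : B.graph.Walk v₀ v₀}

/-- The cut around the left cluster `i` is crossed only by heavy edges, and the trail must cross it
a second time. -/
lemma exists_right_ne (hC : C.IsTrail) {i : I} {j : J} (h : B.heavyEdge i j ∈ C.edges) :
    ∃ j' ≠ j, B.heavyEdge i j' ∈ C.edges := by
  obtain ⟨a, ha, b, hb, hab, hne⟩ := hC.exists_boundary_edge_ne {v | B.cluster v = .inl i}
    (C.fst_mem_support_of_mem_edges h) (C.snd_mem_support_of_mem_edges h)
    (B.cluster_left i j) (by simp [B.cluster_right]) (B.heavyEdge i j)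
  rcases B.eq_of_mem (C.edges_subset_edgeSet hab) with ⟨v, hv⟩ | ⟨i', j', hv⟩
  · exact absurd ((B.cluster_eq_of_eq_lightEdge hv).symm.trans ha) hb
  · rw [hv] at hab hne
    have hi : i' = i := by
      rw [heavyEdge, Sym2.eq_iff] at hv
      rcases hv with ⟨rfl, rfl⟩ | ⟨rfl, rfl⟩ <;> simp_all [B.cluster_left, B.cluster_right]
    subst hi
    exact ⟨j', fun hj => hne (by rw [hj]), hab⟩

lemma exists_left_ne (hC : C.IsTrail) {i : I} {j : J} (h : B.heavyEdge i j ∈ C.edges) :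
    ∃ i' ≠ i, B.heavyEdge i' j ∈ C.edges := by
  obtain ⟨a, ha, b, hb, hab, hne⟩ := hC.exists_boundary_edge_ne {v | B.cluster v = .inr j}
    (C.snd_mem_support_of_mem_edges h) (C.fst_mem_support_of_mem_edges h)
    (B.cluster_right i j) (by simp [B.cluster_left]) (B.heavyEdge i j)
  rcases B.eq_of_mem (C.edges_subset_edgeSet hab) with ⟨v, hv⟩ | ⟨i', j', hv⟩
  · exact absurd ((B.cluster_eq_of_eq_lightEdge hv).symm.trans ha) hb
  · rw [hv] at hab hne
    have hj : j' = j := by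
      rw [heavyEdge, Sym2.eq_iff] at hv
      rcases hv with ⟨rfl, rfl⟩ | ⟨rfl, rfl⟩ <;> simp_all [B.cluster_left, B.cluster_right]
    subst hj
    exact ⟨i', fun hi => hne (by rw [hi]), hab⟩

/-- Without light edges the cut can be taken around the single vertex `B.left i j`, so the second
heavy edge starts at that very vertex and not merely in its cluster. -/
lemma exists_right_ne_of_heavy (hC : C.IsTrail)
    (hheavy : ∀ e ∈ C.edges, ∃ i j, e = B.heavyEdge i j) {i : I} {j : J}
    (h : B.heavyEdge i j ∈ C.edges) :
    ∃ j' ≠ j, B.heavyEdge i j' ∈ C.edges ∧ B.left i j = B.left i j' := by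
  obtain ⟨a, ha, b, hb, hab, hne⟩ := hC.exists_boundary_edge_ne {B.left i j}
    (C.fst_mem_support_of_mem_edges h) (C.snd_mem_support_of_mem_edges h)
    rfl (B.left_ne_right i i j j).symm (B.heavyEdge i j)
  obtain rfl : a = B.left i j := ha
  obtain ⟨i', j', hv⟩ := hheavy _ hab
  rw [hv] at hab hne
  rw [heavyEdge, Sym2.eq_iff] at hv
  rcases hv with ⟨h1, -⟩ | ⟨h1, -⟩
  · have hi : i = i' := by
      have := congrArg B.cluster h1
      simpa [B.cluster_left] using this
    subst hi
    exact ⟨j', fun hj => hne (by rw [hj]), hab, h1⟩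
  · exact absurd h1 (B.left_ne_right _ _ _ _)

lemma exists_left_ne_of_heavy (hC : C.IsTrail)
    (hheavy : ∀ e ∈ C.edges, ∃ i j, e = B.heavyEdge i j) {i : I} {j : J}
    (h : B.heavyEdge i j ∈ C.edges) :
    ∃ i' ≠ i, B.heavyEdge i' j ∈ C.edges ∧ B.right i j = B.right i' j := by
  obtain ⟨a, ha, b, hb, hab, hne⟩ := hC.exists_boundary_edge_ne {B.right i j}
    (C.snd_mem_support_of_mem_edges h) (C.fst_mem_support_of_mem_edges h)
    rfl (B.left_ne_right i i j j) (B.heavyEdge i j)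
  obtain rfl : a = B.right i j := ha
  obtain ⟨i', j', hv⟩ := hheavy _ hab
  rw [hv] at hab hne
  rw [heavyEdge, Sym2.eq_iff] at hv
  rcases hv with ⟨h1, -⟩ | ⟨h1, -⟩
  · exact absurd h1.symm (B.left_ne_right _ _ _ _)
  · have hj : j = j' := by
      have := congrArg B.cluster h1
      simpa [B.cluster_right] using this
    subst hj
    exact ⟨i', fun hi => hne (by rw [hi]), hab, h1⟩

/-- The light edges form disjoint stars, hence a forest: a non-root vertex is a leaf there, and a
cycle cannot pass through a leaf. -/
lemma exists_heavyEdge_mem (hC : C.IsCycle) : ∃ i j, B.heavyEdge i j ∈ C.edges := by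
  by_contra! hno
  have hlight : ∀ e ∈ C.edges, ∃ v, e = B.lightEdge v := by
    intro e he
    rcases B.eq_of_mem (C.edges_subset_edgeSet he) with h | ⟨i, j, rfl⟩
    · exact h
    · exact absurd he (hno i j)
  have hne : C.edges ≠ [] := by
    intro h
    have := hC.three_le_length
    rw [← C.length_edges, h] at this
    simp at this
  obtain ⟨e, he⟩ := List.exists_mem_of_ne_nil _ hne
  obtain ⟨v, rfl⟩ := hlight e he
  have hroot : v ≠ B.root (B.cluster v) := (C.adj_of_mem_edges he).ne
  obtain ⟨a, ha, b, hb, hab, hne⟩ := hC.1.1.exists_boundary_edge_ne {v}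
    (C.fst_mem_support_of_mem_edges he) (C.snd_mem_support_of_mem_edges he)
    rfl hroot.symm (B.lightEdge v)
  obtain rfl : a = v := ha
  obtain ⟨w, hw⟩ := hlight _ hab
  have hcl := B.cluster_eq_of_eq_lightEdge hw
  rw [lightEdge, Sym2.eq_iff] at hw
  rcases hw with ⟨rfl, rfl⟩ | ⟨h1, rfl⟩
  · exact hne rfl
  · rw [hcl] at hroot
    exact hroot h1

/-- The weight of a cycle is at least `4 + ε`: it has four edges between different clusters, and a
further edge. -/
lemma le_normalizedWeight (hε1 : ε ≤ 1) (hC : C.IsCycle) :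
    4 + ε ≤ (B.weighted ε hε).normalizedWeight C := by
  classical
  obtain ⟨i, j, h⟩ := B.exists_heavyEdge_mem hC
  by_cases hheavy : ∀ e ∈ C.edges, ∃ i j, e = B.heavyEdge i j
  · obtain ⟨j₁, hj₁, h₁, e₁⟩ := B.exists_right_ne_of_heavy hC.1.1 hheavy h
    obtain ⟨i₂, hi₂, h₂, e₂⟩ := B.exists_left_ne_of_heavy hC.1.1 hheavy h
    obtain ⟨i₃, hi₃, h₃, e₃⟩ := B.exists_left_ne_of_heavy hC.1.1 hheavy h₁
    obtain ⟨j₄, hj₄, h₄, e₄⟩ := B.exists_right_ne_of_heavy hC.1.1 hheavy h₂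
    -- If the two outer edges coincided, the heavy edges would close a 4-cycle. So there are five
    -- distinct heavy edges, of total weight `5 ≥ 4 + ε`.
    have hne : ¬ (i₃ = i₂ ∧ j₁ = j₄) := by
      rintro ⟨rfl, rfl⟩
      rcases B.no_four_cycle _ _ _ _ e₁ e₄ e₂ e₃ with h | h
      · exact hi₂ h.symm
      · exact hj₁ h.symm
    have hs : ∀ e ∈ ({B.heavyEdge i j, B.heavyEdge i j₁, B.heavyEdge i₂ j, B.heavyEdge i₃ j₁,
        B.heavyEdge i₂ j₄} : Finset (Sym2 V)), e ∈ C.edges := by simp [h, h₁, h₂, h₃, h₄]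
    have := WeightedGraph.sum_le_normalizedWeight (B.weight_le_one (hε := hε) hε1) hC hs
    rw [Finset.sum_insert, Finset.sum_insert, Finset.sum_insert, Finset.sum_insert,
      Finset.sum_singleton] at this
    · simp only [B.weight_heavyEdge] at this
      linarith
    all_goals
      simp only [Finset.mem_insert, Finset.mem_singleton, B.heavyEdge_inj]
      grind
  · push Not at hheavy
    obtain ⟨e, he, hne⟩ := hheavy
    obtain ⟨v, rfl⟩ : ∃ v, e = B.lightEdge v := by
      rcases B.eq_of_mem (C.edges_subset_edgeSet he) with h | ⟨i, j, rfl⟩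
      · exact h
      · exact absurd rfl (hne i j)
    -- Here the fifth edge is light, so `i₃ = i₂` is allowed: the four heavy edges are distinct in
    -- any case.
    obtain ⟨j₁, hj₁, h₁⟩ := B.exists_right_ne hC.1.1 h
    obtain ⟨i₂, hi₂, h₂⟩ := B.exists_left_ne hC.1.1 h
    obtain ⟨i₃, hi₃, h₃⟩ := B.exists_left_ne hC.1.1 h₁
    have hs : ∀ e ∈ ({B.lightEdge v, B.heavyEdge i j, B.heavyEdge i j₁, B.heavyEdge i₂ j,
        B.heavyEdge i₃ j₁} : Finset (Sym2 V)), e ∈ C.edges := by simp [h, h₁, h₂, h₃, he]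
    have := WeightedGraph.sum_le_normalizedWeight (B.weight_le_one (hε := hε) hε1) hC hs
    rw [Finset.sum_insert, Finset.sum_insert, Finset.sum_insert, Finset.sum_insert,
      Finset.sum_singleton] at this
    · simp only [B.weight_heavyEdge, B.weight_lightEdge] at this
      linarith
    all_goals
      simp only [Finset.mem_insert, Finset.mem_singleton, B.heavyEdge_inj,
        fun i j => (B.heavyEdge_ne_lightEdge i j v).symm]
      grind

end Cycle

/-! ### Weighted girth of the clustered graph, from below and from above -/

lemma le_weightedGirth (hε1 : ε ≤ 1) :
    ((4 + ε : ℝ) : EReal) ≤ (B.weighted ε hε).weightedGirth :=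
  le_iInf fun _ => le_iInf fun _ => le_iInf fun hC =>
    EReal.coe_le_coe_iff.2 (B.le_normalizedWeight hε1 hC)

lemma adj_left_right (i : I) (j : J) : B.graph.Adj (B.left i j) (B.right i j) :=
  B.heavyEdge_mem i j

lemma adj_root {v : V} {k : I ⊕ J} (hv : B.cluster v = k) (hne : v ≠ B.root k) :
    B.graph.Adj v (B.root k) := by
  subst hv
  rw [graph, SimpleGraph.fromEdgeSet_adj]
  exact ⟨Or.inl ⟨v, rfl⟩, hne⟩

/-- A `6`-cycle with two light edges. -/
lemma weightedGirth_le (hε1 : ε ≤ 1) {i i' : I} {j j' : J} (hi : i ≠ i') (hj : j ≠ j')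
    (h1 : B.left i j = B.left i j') (h2 : B.right i j = B.right i' j)
    (h3 : B.left i' j = B.root (.inl i')) (h4 : B.right i j' = B.root (.inr j'))
    (h5 : B.left i' j' ≠ B.root (.inl i')) (h6 : B.right i' j' ≠ B.root (.inr j')) :
    (B.weighted ε hε).weightedGirth ≤ ((4 + 2 * ε : ℝ) : EReal) := by
  have a1 : B.graph.Adj (B.left i j) (B.right i j) := B.adj_left_right i j
  have a2 : B.graph.Adj (B.right i j) (B.root (.inl i')) := by
    rw [h2, ← h3]
    exact (B.adj_left_right i' j).symm
  have a3 : B.graph.Adj (B.root (.inl i')) (B.left i' j') :=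
    (B.adj_root (B.cluster_left i' j') h5).symm
  have a4 : B.graph.Adj (B.left i' j') (B.right i' j') := B.adj_left_right i' j'
  have a5 : B.graph.Adj (B.right i' j') (B.root (.inr j')) := B.adj_root (B.cluster_right i' j') h6
  have a6 : B.graph.Adj (B.root (.inr j')) (B.left i j) := by
    rw [h1, ← h4]
    exact (B.adj_left_right i j').symm
  let C : B.graph.Walk (B.left i j) (B.left i j) :=
    .cons a1 (.cons a2 (.cons a3 (.cons a4 (.cons a5 (.cons a6 .nil)))))
  have ne_of_cluster : ∀ {a b : V}, B.cluster a ≠ B.cluster b → a ≠ b :=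
    fun h hab => h (by rw [hab])
  have n13 : B.left i j ≠ B.root (.inl i') :=
    ne_of_cluster (by simpa [B.cluster_left, B.cluster_root] using hi)
  have n14 : B.left i j ≠ B.left i' j' := ne_of_cluster (by simpa [B.cluster_left] using hi)
  have n15 := B.left_ne_right i i' j j'
  have n24 := (B.left_ne_right i' i j' j).symm
  have n25 : B.right i j ≠ B.right i' j' := ne_of_cluster (by simpa [B.cluster_right] using hj)
  have n26 : B.right i j ≠ B.root (.inr j') :=
    ne_of_cluster (by simpa [B.cluster_right, B.cluster_root] using hj)
  have n35 : B.root (.inl i') ≠ B.right i' j' :=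
    ne_of_cluster (by simp [B.cluster_right, B.cluster_root])
  have n36 : B.root (.inl i') ≠ B.root (.inr j') := ne_of_cluster (by simp [B.cluster_root])
  have n46 : B.left i' j' ≠ B.root (.inr j') :=
    ne_of_cluster (by simp [B.cluster_left, B.cluster_root])
  have hC : C.IsCycle := by
    simp only [C, SimpleGraph.Walk.isCycle_def, SimpleGraph.Walk.isTrail_def]
    simp [a1.ne, a2.ne, a3.ne, a4.ne, a5.ne, a6.ne, n13, n14, n15, n24, n25, n26, n35, n36, n46,
      a1.ne', a6.ne', n13.symm, n14.symm, n15.symm]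
  refine (WeightedGraph.weightedGirth_le (G := B.weighted ε hε) hC).trans
    (EReal.coe_le_coe_iff.2 ?_)
  have w1 : (B.weighted ε hε).weight s(B.left i j, B.right i j) = 1 := B.weight_heavyEdge i j
  have w2 : (B.weighted ε hε).weight s(B.right i j, B.root (.inl i')) = 1 := by
    rw [h2, ← h3, Sym2.eq_swap]
    exact B.weight_heavyEdge i' j
  have w3 : (B.weighted ε hε).weight s(B.root (.inl i'), B.left i' j') = ε := by
    rw [Sym2.eq_swap, ← B.cluster_left i' j']
    exact B.weight_lightEdge _
  have w4 : (B.weighted ε hε).weight s(B.left i' j', B.right i' j') = 1 := B.weight_heavyEdge i' j'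
  have w5 : (B.weighted ε hε).weight s(B.right i' j', B.root (.inr j')) = ε := by
    rw [← B.cluster_right i' j']
    exact B.weight_lightEdge _
  have w6 : (B.weighted ε hε).weight s(B.root (.inr j'), B.left i j) = 1 := by
    rw [h1, ← h4, Sym2.eq_swap]
    exact B.weight_heavyEdge i j'
  have hsum : (C.edges.map (B.weighted ε hε).weight).sum = 4 + 2 * ε := by
    simp only [C, SimpleGraph.Walk.edges_cons, SimpleGraph.Walk.edges_nil, List.map_cons,
      List.map_nil, List.sum_cons, List.sum_nil, w1, w2, w3, w4, w5, w6]
    ring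
  have hsup : 1 ≤ sSup ((B.weighted ε hε).weight '' {e | e ∈ C.edges}) :=
    le_csSup ⟨1, by rintro x ⟨e, -, rfl⟩; exact B.weight_le_one hε1 e⟩
      ⟨_, by simp [C], w1⟩
  have h0 : 0 ≤ 4 + 2 * ε := by linarith
  exact (div_le_self (h0.trans_eq hsum.symm) hsup).trans_eq hsum

/-! ### Connectivity and lightness of the clustered graph -/

/-- A connected spanning subgraph of small weight. -/
def skeleton (i₀ : I) (j₀ : J) : SimpleGraph V :=
  .fromEdgeSet (Set.range B.lightEdge ∪
    (Set.range (fun i => B.heavyEdge i j₀) ∪ Set.range (fun j => B.heavyEdge i₀ j)))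

lemma skeleton_le (i₀ : I) (j₀ : J) : B.skeleton i₀ j₀ ≤ B.graph := by
  refine SimpleGraph.fromEdgeSet_mono (Set.union_subset_union_right _ (Set.union_subset ?_ ?_))
  · rintro _ ⟨i, rfl⟩
    exact ⟨(i, j₀), rfl⟩
  · rintro _ ⟨j, rfl⟩
    exact ⟨(i₀, j), rfl⟩

lemma skeleton_connected (i₀ : I) (j₀ : J) : (B.skeleton i₀ j₀).Connected := by
  have hlight : ∀ v, (B.skeleton i₀ j₀).Reachable v (B.root (B.cluster v)) := by
    intro v
    by_cases hv : v = B.root (B.cluster v)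
    · rw [← hv]
    · refine SimpleGraph.Adj.reachable ?_
      rw [skeleton, SimpleGraph.fromEdgeSet_adj]
      exact ⟨Or.inl ⟨v, rfl⟩, hv⟩
  have hleft : ∀ i, (B.skeleton i₀ j₀).Reachable (B.root (.inl i)) (B.root (.inr j₀)) := by
    intro i
    have h1 := hlight (B.left i j₀)
    have h2 := hlight (B.right i j₀)
    rw [B.cluster_left] at h1
    rw [B.cluster_right] at h2
    refine h1.symm.trans (SimpleGraph.Reachable.trans (SimpleGraph.Adj.reachable ?_) h2)
    rw [skeleton, SimpleGraph.fromEdgeSet_adj]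
    exact ⟨Or.inr (Or.inl ⟨i, rfl⟩), B.left_ne_right _ _ _ _⟩
  have hright : ∀ j, (B.skeleton i₀ j₀).Reachable (B.root (.inr j)) (B.root (.inl i₀)) := by
    intro j
    have h1 := hlight (B.left i₀ j)
    have h2 := hlight (B.right i₀ j)
    rw [B.cluster_left] at h1
    rw [B.cluster_right] at h2
    refine h2.symm.trans (SimpleGraph.Reachable.trans (SimpleGraph.Adj.reachable ?_) h1)
    rw [SimpleGraph.adj_comm, skeleton, SimpleGraph.fromEdgeSet_adj]
    exact ⟨Or.inr (Or.inr ⟨j, rfl⟩), B.left_ne_right _ _ _ _⟩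
  have hall : ∀ v, (B.skeleton i₀ j₀).Reachable v (B.root (.inr j₀)) := by
    intro v
    refine (hlight v).trans ?_
    rcases B.cluster v with i | j
    · exact hleft i
    · exact (hright j).trans (hleft i₀)
  have : Nonempty V := ⟨B.root (.inl i₀)⟩
  exact ⟨fun v w => (hall v).trans (hall w).symm⟩

lemma graph_connected (i₀ : I) (j₀ : J) : B.graph.Connected :=
  (B.skeleton_connected i₀ j₀).mono (B.skeleton_le i₀ j₀)

lemma edgeWeight_skeleton_le [Fintype V] [Fintype I] [Fintype J] (i₀ : I) (j₀ : J) :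
    WeightedGraph.edgeWeight (B.weighted ε hε).weight (B.skeleton i₀ j₀) ≤
      Fintype.card V * ε + (Fintype.card I + Fintype.card J) := by
  classical
  rw [WeightedGraph.edgeWeight_eq_sum]
  have hnonneg : ∀ e, 0 ≤ (B.weighted ε hε).weight e := by
    intro e
    simp only [weighted]
    split_ifs <;> linarith
  have hunion : ∀ s t : Finset (Sym2 V), ∑ e ∈ s ∪ t, (B.weighted ε hε).weight e ≤
      ∑ e ∈ s, (B.weighted ε hε).weight e + ∑ e ∈ t, (B.weighted ε hε).weight e := by
    intro s t
    rw [← Finset.sum_union_inter]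
    linarith [Finset.sum_nonneg fun e (_ : e ∈ s ∩ t) => hnonneg e]
  have hsub : (Set.toFinite (B.skeleton i₀ j₀).edgeSet).toFinset ⊆
      Finset.univ.image B.lightEdge ∪ (Finset.univ.image (fun i => B.heavyEdge i j₀) ∪
        Finset.univ.image (fun j => B.heavyEdge i₀ j)) := by
    intro e he
    rw [Set.Finite.mem_toFinset, skeleton, SimpleGraph.edgeSet_fromEdgeSet] at he
    simpa using he.1
  have h1 : ∑ e ∈ Finset.univ.image B.lightEdge, (B.weighted ε hε).weight e ≤
      ∑ v, (B.weighted ε hε).weight (B.lightEdge v) :=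
    Finset.sum_image_le_of_nonneg fun x _ => hnonneg _
  have h2 : ∑ e ∈ Finset.univ.image (fun i => B.heavyEdge i j₀), (B.weighted ε hε).weight e ≤
      ∑ i, (B.weighted ε hε).weight (B.heavyEdge i j₀) :=
    Finset.sum_image_le_of_nonneg fun x _ => hnonneg _
  have h3 : ∑ e ∈ Finset.univ.image (fun j => B.heavyEdge i₀ j), (B.weighted ε hε).weight e ≤
      ∑ j, (B.weighted ε hε).weight (B.heavyEdge i₀ j) :=
    Finset.sum_image_le_of_nonneg fun x _ => hnonneg _
  simp only [B.weight_lightEdge, B.weight_heavyEdge, Finset.sum_const, Finset.card_univ,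
    nsmul_eq_mul, mul_one] at h1 h2 h3
  have h4 := Finset.sum_le_sum_of_subset_of_nonneg hsub fun e _ _ => hnonneg e
  have h5 := hunion (Finset.univ.image B.lightEdge)
    (Finset.univ.image (fun i => B.heavyEdge i j₀) ∪
      Finset.univ.image (fun j => B.heavyEdge i₀ j))
  have h6 := hunion (Finset.univ.image (fun i => B.heavyEdge i j₀))
    (Finset.univ.image (fun j => B.heavyEdge i₀ j))
  linarith

lemma le_edgeWeight [Finite V] [Fintype I] [Fintype J] :
    (Fintype.card I * Fintype.card J : ℝ) ≤
      WeightedGraph.edgeWeight (B.weighted ε hε).weight (B.weighted ε hε).graph := by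
  classical
  rw [WeightedGraph.edgeWeight_eq_sum]
  have hsub : Finset.univ.image (fun p : I × J => B.heavyEdge p.1 p.2) ⊆
      (Set.toFinite (B.weighted ε hε).graph.edgeSet).toFinset := by
    intro e he
    obtain ⟨p, -, rfl⟩ := Finset.mem_image.1 he
    rw [Set.Finite.mem_toFinset]
    exact B.heavyEdge_mem p.1 p.2
  refine le_trans (le_of_eq ?_) (Finset.sum_le_sum_of_subset_of_nonneg hsub fun e he _ =>
    ((B.weighted ε hε).weight_pos e (by simpa using he)).le)
  rw [Finset.sum_image fun p _ q _ h => Prod.ext_iff.2 (B.heavyEdge_inj.1 h)]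
  simp [B.weight_heavyEdge]

lemma le_lightness [Fintype V] [Nontrivial V] [Fintype I] [Fintype J] (i₀ : I) (j₀ : J) :
    (Fintype.card I * Fintype.card J : ℝ) /
        (Fintype.card V * ε + (Fintype.card I + Fintype.card J)) ≤
      (B.weighted ε hε).lightness :=
  WeightedGraph.le_lightness (G := B.weighted ε hε) (B.skeleton_le i₀ j₀)
    (B.skeleton_connected i₀ j₀) (by positivity) B.le_edgeWeight
    (B.edgeWeight_skeleton_le i₀ j₀)

end BipartiteClustering

/-! ### The clustering over `ZMod p` -/

namespace BipartiteClustering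

/-- Clusters that are indexed by pairs `(x, y)` on the left and `(u, v)` on the right, of size at
least `p`: the edge between the clusters `(x, y)` and `(u, v)` joins the node `x * u + v` of the
first one to the node `x * u + y` of the second one. -/
def ofSurjective {V : Type*} {p : ℕ} [Fact p.Prime]
    (f : V → ((ZMod p × ZMod p) ⊕ (ZMod p × ZMod p)) × ZMod p) (hf : f.Surjective) :
    BipartiteClustering V (ZMod p × ZMod p) (ZMod p × ZMod p) where
  cluster v := (f v).1
  root k := Function.surjInv hf (k, 0)
  left i j := Function.surjInv hf (.inl i, i.1 * j.1 + j.2)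
  right i j := Function.surjInv hf (.inr j, i.1 * j.1 + i.2)
  cluster_root k := by rw [Function.surjInv_eq hf]
  cluster_left i j := by rw [Function.surjInv_eq hf]
  cluster_right i j := by rw [Function.surjInv_eq hf]
  no_four_cycle := by
    rintro ⟨x, y⟩ ⟨x', y'⟩ ⟨u, v⟩ ⟨u', v'⟩ h1 h2 h3 h4
    simp only [(Function.injective_surjInv hf).eq_iff, Prod.mk.injEq, true_and] at h1 h2 h3 h4 ⊢
    -- Equal left endpoints say `x * u + v = x * u' + v'`, and likewise for `x'`; subtracting
    -- eliminates `v` and `v'`.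
    have h : (x - x') * (u - u') = 0 := by linear_combination h1 - h2
    rcases mul_eq_zero.1 h with h | h
    · have hx : x = x' := sub_eq_zero.1 h
      subst hx
      exact Or.inl ⟨rfl, by linear_combination h3⟩
    · have hu : u = u' := sub_eq_zero.1 h
      subst hu
      exact Or.inr ⟨rfl, by linear_combination h1⟩

lemma ofSurjective_weightedGirth_le {V : Type*} {p : ℕ} [Fact p.Prime]
    (f : V → ((ZMod p × ZMod p) ⊕ (ZMod p × ZMod p)) × ZMod p) (hf : f.Surjective) {ε : ℝ}
    (hε : 0 < ε) (hε1 : ε ≤ 1) :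
    ((ofSurjective f hf).weighted ε hε).weightedGirth ≤ ((4 + 2 * ε : ℝ) : EReal) := by
  -- All endpoints are node 0, the root, except those of the edge from `i'` to `j'`, where `x * u =
  -- 1`.
  refine weightedGirth_le _ hε1 (i := (0, 0)) (i' := (1, 0)) (j := (0, 0)) (j' := (1, 0))
    ?_ ?_ ?_ ?_ ?_ ?_ ?_ ?_ <;>
    simp [ofSurjective, (Function.injective_surjInv hf).eq_iff]

end BipartiteClustering

/-! ### Choice of parameters and comparison with unweighted graphs -/

namespace WeightedGraph

/-- Take `m` with `16 m ^ 3 ≤ n < 16 (m + 1) ^ 3` and apply Bertrand's postulate to get a prime `p`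
with `m < p ≤ 2m`. -/
lemma exists_prime_cube {n : ℕ} (hn : 16 ≤ n) :
    ∃ p : ℕ, p.Prime ∧ 2 * p ^ 3 ≤ n ∧ n ≤ 16 * p ^ 3 := by
  have hex : ∃ m : ℕ, n < 16 * (m + 1) ^ 3 := 
    ⟨n, by nlinarith [Nat.le_self_pow (n := 3) (by norm_num) (n + 1)]⟩
  classical
  set m := Nat.find hex with hm
  have h1 : n < 16 * (m + 1) ^ 3 := Nat.find_spec hex
  have hm0 : m ≠ 0 := by
    intro h
    rw [h] at h1
    omega
  have h2 : 16 * m ^ 3 ≤ n := by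
    have := Nat.find_min hex (m := m - 1) (by omega)
    rw [Nat.sub_add_cancel (by omega)] at this
    omega
  obtain ⟨p, hp, hmp, hpm⟩ := Nat.exists_prime_lt_and_le_two_mul m hm0
  refine ⟨p, hp, ?_, ?_⟩
  · have := Nat.pow_le_pow_left hpm 3
    rw [mul_pow] at this
    omega
  · have := Nat.pow_le_pow_left (show m + 1 ≤ p from hmp) 3
    omega

/-- There are graphs of weighted girth slightly larger than `4` and of lightness
`Ω(n ^ (2 / 3))`. -/
theorem exists_large_lightness {n : ℕ} (hn : 16 ≤ n) : ∃ g : ℝ, 4 < g ∧ g < 5 ∧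
    ∃ H : WeightedGraph (Fin n), H.graph.Connected ∧ H.weightedGirth = (g : EReal) ∧
      1 / 48 * (n : ℝ) ^ ((2 : ℝ) / 3) ≤ H.lightness := by
  obtain ⟨p, hp, hpn, hnp⟩ := exists_prime_cube hn
  have : Fact p.Prime := ⟨hp⟩
  have hcard : Fintype.card (((ZMod p × ZMod p) ⊕ (ZMod p × ZMod p)) × ZMod p) ≤
      Fintype.card (Fin n) := by
    simp only [Fintype.card_prod, Fintype.card_sum, ZMod.card, Fintype.card_fin]
    linarith
  obtain ⟨f⟩ := Function.Embedding.nonempty_of_card_le hcard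
  -- The left inverse of an embedding places the surplus nodes in some cluster, so every `n ≥ 2 p ^
  -- 3` is handled.
  have hf : (Function.invFun f).Surjective := Function.invFun_surjective f.injective
  have hn' : (16 : ℝ) ≤ n := by exact_mod_cast hn
  have hε : (0 : ℝ) < 1 / n := by positivity
  have hε1 : (1 : ℝ) / n ≤ 1 / 16 := by gcongr
  have hnt : Nontrivial (Fin n) := Fin.nontrivial_iff_two_le.2 (by omega)
  let B := BipartiteClustering.ofSurjective _ hf
  have hlo := B.le_weightedGirth (hε := hε) (by linarith)
  have hup := BipartiteClustering.ofSurjective_weightedGirth_le _ hf hε (by linarith)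
  have hlight := B.le_lightness (hε := hε) 0 0
  obtain ⟨g, hg⟩ : ∃ g : ℝ, (B.weighted _ hε).weightedGirth = (g : EReal) := by
    refine ⟨_, (EReal.coe_toReal ?_ ?_).symm⟩
    · exact fun h => absurd (h ▸ hup) (not_le.2 (EReal.coe_lt_top _))
    · exact fun h => absurd (h ▸ hlo) (not_le.2 (EReal.bot_lt_coe _))
  have hlo' := hlo
  have hup' : (B.weighted _ hε).weightedGirth ≤ _ := hup
  rw [hg, EReal.coe_le_coe_iff] at hlo' hup'
  refine ⟨g, by linarith, by linarith, B.weighted _ hε, B.graph_connected 0 0, hg,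
    le_trans ?_ hlight⟩
  simp only [Fintype.card_prod, ZMod.card, Fintype.card_fin, Nat.cast_mul]
  have hp1 : (1 : ℝ) ≤ p := by exact_mod_cast hp.one_le
  have hp2 : (1 : ℝ) ≤ (p : ℝ) * p := by nlinarith
  rw [mul_one_div_cancel (by positivity : (n : ℝ) ≠ 0), le_div_iff₀ (by positivity)]
  have h1 : (n : ℝ) ^ ((2 : ℝ) / 3) ≤ 16 * ((p : ℝ) * p) := by
    have h2 : (n : ℝ) ≤ 16 * (p : ℝ) ^ 3 := by exact_mod_cast hnp
    calc (n : ℝ) ^ ((2 : ℝ) / 3) ≤ (16 * (p : ℝ) ^ 3) ^ ((2 : ℝ) / 3) := by gcongr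
      _ = 16 ^ ((2 : ℝ) / 3) * ((p : ℝ) ^ 3) ^ ((2 : ℝ) / 3) :=
        Real.mul_rpow (by norm_num) (by positivity)
      _ = 16 ^ ((2 : ℝ) / 3) * ((p : ℝ) * p) := by
        congr 1
        rw [← Real.rpow_natCast_mul (by positivity), ← sq, ← Real.rpow_natCast]
        norm_num
      _ ≤ 16 ^ (1 : ℝ) * ((p : ℝ) * p) := by
        gcongr <;> norm_num
      _ = 16 * ((p : ℝ) * p) := by rw [Real.rpow_one]
  -- The denominator is `1 + 2 p ^ 2 ≤ 3 p ^ 2`, so the lightness is at least `p ^ 2 / 3`; with `n ^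
  -- (2 / 3) ≤ 16 p ^ 2` this yields the constant `1 / 48`.
  nlinarith

lemma eventually_unweighted_lt : ∀ᶠ n : ℕ in atTop, 16 ≤ n ∧
    2 * (n : ℝ) ^ ((1 : ℝ) / 2) < 1 / 48 * (n : ℝ) ^ ((2 : ℝ) / 3) := by
  -- The ratio of the two powers is `n ^ (1 / 6)`, which has to exceed `2 * 48 = 96`.
  have h := ((tendsto_rpow_atTop (show (0 : ℝ) < 1 / 6 by norm_num)).comp
    tendsto_natCast_atTop_atTop).eventually_gt_atTop 96
  filter_upwards [h, eventually_ge_atTop 16] with n hn hn16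
  refine ⟨hn16, ?_⟩
  have hpos : (0 : ℝ) < n := by exact_mod_cast (by omega : 0 < n)
  have h1 : (n : ℝ) ^ ((2 : ℝ) / 3) = (n : ℝ) ^ ((1 : ℝ) / 2) * (n : ℝ) ^ ((1 : ℝ) / 6) := by
    rw [← Real.rpow_add hpos]
    norm_num
  have h2 : 0 < (n : ℝ) ^ ((1 : ℝ) / 2) := by positivity
  simp only [Function.comp_apply] at hn
  rw [h1]
  nlinarith

/-- For large `n`, some graph of weighted girth `g` with `4 < g < 5` is heavier than all unweighted
graphs of girth more than `4`. -/
lemma eventually_exists_unweighted_lt : ∀ᶠ n : ℕ in atTop, ∃ g : ℝ, 4 < g ∧ g < 5 ∧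
    ∃ H : WeightedGraph (Fin n), H.graph.Connected ∧ H.weightedGirth = (g : EReal) ∧
      1 / 48 * (n : ℝ) ^ ((2 : ℝ) / 3) ≤ H.lightness ∧
      ∀ U : WeightedGraph (Fin n), U.graph.Connected → U.IsUnweighted →
        ((4 : ℝ) : EReal) < U.weightedGirth → U.lightness < H.lightness := by
  filter_upwards [eventually_unweighted_lt] with n hn
  obtain ⟨g, h4, h5, H, hH, hg, hl⟩ := exists_large_lightness hn.1
  exact ⟨g, h4, h5, H, hH, hg, hl, fun U hU hU' hU4 =>
    (lightness_le_of_isUnweighted (by omega) hU hU' hU4).trans_lt (hn.2.trans_le hl)⟩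

/-- Covers all three variants at once: the sets `Set.Ioi 4`, `{g}` and `Set.Ici g` with `g > 4` all
lie strictly above 4. -/
lemma not_maximizedByUnweighted {n : ℕ} {S : Set EReal} {H : WeightedGraph (Fin n)}
    (hH : H.graph.Connected) (hS : H.weightedGirth ∈ S) (hS4 : ∀ x ∈ S, ((4 : ℝ) : EReal) < x)
    (h : ∀ U : WeightedGraph (Fin n), U.graph.Connected → U.IsUnweighted →
        ((4 : ℝ) : EReal) < U.weightedGirth → U.lightness < H.lightness) :
    ¬ MaximizedByUnweighted n S := by
  intro hmax
  obtain ⟨U, hU, hUS, hU', hle⟩ := hmax ⟨H, hH, hS⟩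
  exact (hle H hH hS).not_gt (h U hU hU' (hS4 _ hUS))

end WeightedGraph

end

theorem mainTheorem3 :
    -- the variant for weighted girth strictly larger than an integer `g` is false,
    -- namely for `g = 4` and every large `n`
    (¬ ∀ n g : ℕ, 0 < n → 0 < g →
      WeightedGraph.MaximizedByUnweighted n (Set.Ioi ((g : ℝ) : EReal))) ∧
    (∀ᶠ n : ℕ in atTop,
      ¬ WeightedGraph.MaximizedByUnweighted n (Set.Ioi ((4 : ℝ) : EReal))) ∧
    -- the variant for real `g` is false, for weighted girth exactly `g` and at least `g`
    (¬ ∀ (n : ℕ) (g : ℝ), 0 < n → 0 < g →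
      WeightedGraph.MaximizedByUnweighted n {(g : EReal)}) ∧
    (¬ ∀ (n : ℕ) (g : ℝ), 0 < n → 0 < g →
      WeightedGraph.MaximizedByUnweighted n (Set.Ici (g : EReal))) ∧
    -- for every large `n` there is a non-integral `g` in `(4, 5)` and a graph of weighted girth
    -- exactly `g` with lightness `Ω(n ^ (2 / 3))`, more than the lightness of every unweighted
    -- graph of weighted girth at least `g`
    (∃ c : ℝ, 0 < c ∧ ∀ᶠ n : ℕ in atTop, ∃ g : ℝ, 4 < g ∧ g < 5 ∧
      ∃ H : WeightedGraph (Fin n), H.graph.Connected ∧ H.weightedGirth = (g : EReal) ∧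
        c * (n : ℝ) ^ ((2 : ℝ) / 3) ≤ H.lightness ∧
        ∀ U : WeightedGraph (Fin n), U.graph.Connected → U.IsUnweighted →
          (g : EReal) ≤ U.weightedGirth → U.lightness < H.lightness) ∧
    -- some graphs of weighted girth larger than `4` have lightness `Ω(n ^ (2 / 3))` ...
    (∃ c : ℝ, 0 < c ∧ ∀ᶠ n : ℕ in atTop, ∃ H : WeightedGraph (Fin n),
      H.graph.Connected ∧ ((4 : ℝ) : EReal) < H.weightedGirth ∧
        c * (n : ℝ) ^ ((2 : ℝ) / 3) ≤ H.lightness) ∧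
    -- ... whereas graphs of girth larger than `4` have `O(n ^ (3 / 2))` edges
    (∃ C : ℝ, 0 < C ∧ ∀ (n : ℕ) (G : SimpleGraph (Fin n)), 4 < G.egirth →
      (G.edgeSet.ncard : ℝ) ≤ C * (n : ℝ) ^ ((3 : ℝ) / 2)) := by
  have key := WeightedGraph.eventually_exists_unweighted_lt
  have hgt : ∀ᶠ n : ℕ in atTop,
      ¬ WeightedGraph.MaximizedByUnweighted n (Set.Ioi ((4 : ℝ) : EReal)) := by
    filter_upwards [key] with n ⟨g, h4, h5, H, hH, hg, _, hlt⟩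
    exact WeightedGraph.not_maximizedByUnweighted hH
      (by rw [hg]; exact EReal.coe_lt_coe_iff.2 h4) (fun _ hx => hx) hlt
  obtain ⟨n, ⟨g, h4, h5, H, hH, hg, -, hlt⟩, hn⟩ := (key.and (eventually_gt_atTop 0)).exists
  have h4' : ((4 : ℝ) : EReal) < g := EReal.coe_lt_coe_iff.2 h4
  refine ⟨fun h => ?_, hgt, fun h => ?_, fun h => ?_, ⟨1 / 48, by norm_num, ?_⟩,
    ⟨1 / 48, by norm_num, ?_⟩, ⟨1, one_pos, fun n G hG => ?_⟩⟩
  · obtain ⟨n, hn, hn0⟩ := (hgt.and (eventually_gt_atTop 0)).exists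
    exact hn (by exact_mod_cast h n 4 hn0 (by norm_num))
  · exact WeightedGraph.not_maximizedByUnweighted hH hg (by rintro x rfl; exact h4') hlt
      (h n g hn (by linarith))
  · exact WeightedGraph.not_maximizedByUnweighted hH hg.ge (fun x hx => h4'.trans_le hx) hlt
      (h n g hn (by linarith))
  · filter_upwards [key] with n ⟨g, h4, h5, H, hH, hg, hl, hlt⟩
    exact ⟨g, h4, h5, H, hH, hg, hl, fun U hU hU' hUg =>
      hlt U hU hU' ((EReal.coe_lt_coe_iff.2 h4).trans_le hUg)⟩
  · filter_upwards [key] with n ⟨g, h4, h5, H, hH, hg, hl, hlt⟩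
    exact ⟨H, hH, by rw [hg]; exact EReal.coe_lt_coe_iff.2 h4, hl⟩
  · rw [one_mul]
    exact SimpleGraph.ncard_edgeSet_le_rpow hG
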